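/- For $d \in \mathbb{N}$ let $a_0,\dots,a_d$ be independent standard normal random variables (mean $0$, variance $1$), and let $$P_d(x) = \sum_{k=0}^{d} a_k \sqrt{\binom{2d}{2k}}\; x^{2k}.$$ Let $N_d$ be the number of distinct real roots of $P_d$, that is, the number of $x \in \mathbb{R}$ with $P_d(x)=0$ (on the null event $P_d = 0$ we put $N_d = 0$). Then $N_d$ is integrable and its expectation is $\sqrt{2d} \pm O(1)$: there is an absolute constant $C$ such that for every $d \in \mathbb{N}$ $$\bigl|\,\mathbb{E}[N_d] - \sqrt{2d}\,\bigr| \le C.$$ -/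

import Mathlib

open MeasureTheory ProbabilityTheory

/-- The polynomial `∑_{k=0}^{d} a_k √(C(2d,2k)) x^{2k}` with coefficient vector `a`. -/
noncomputable def evenBinomialPoly (d : ℕ) (a : Fin (d + 1) → ℝ) : Polynomial ℝ :=
  ∑ k : Fin (d + 1),
    Polynomial.C (a k * √((Nat.choose (2 * d) (2 * (k : ℕ)) : ℕ) : ℝ)) *
      Polynomial.X ^ (2 * (k : ℕ))

/-- The number of (distinct) real roots of a real polynomial; for a nonzero polynomial this is a
finite set, and the zero polynomial gets the value `0`. -/
noncomputable def numRealRoots (p : Polynomial ℝ) : ℕ :=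
  Set.ncard {x : ℝ | p.IsRoot x}

/-! Let d = m + 1, y = x², let φ be the standard normal density, u the constant coefficient and b
the vector of the others. Then P_d(x) = u - g_b(x), so the roots of P_d form the fibre of g_b over
u. For fixed b the mean root count is ∫ #g_b⁻¹(u) φ(u) du, which the area formula
`lintegral_encard_fiber_mul` turns into ∫ |g_b'(x)| φ(g_b(x)) dx. After exchanging this with the
mean over b, the pair (g_b(x), g_b'(x)) is a centred Gaussian vector, and
`lintegral_abs_mul_gaussianPDF_of_hasGaussianLaw` evaluates the mean from its covariances. These
come from the even part of (1 + y)^(2d) and its Euler derivatives, so the density of roots is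
exactly `zeroDensity m y / π`.

This density is compared with √(2d) / (π(1 + y)), whose integral over x is √(2d). By
`abs_zeroDensity_sub_le` the two differ noticeably only for |x| of order at most 1/√d or at least
√d. The error terms carry a factor √(2d) but integrate to multiples of π/√d, so the total error is
O(1). -/

/-! ### The area formula on the line. -/

/-- A set on which every point has a neighbourhood where `g` is injective splits into countably many
disjoint measurable pieces on each of which `g` is injective. -/
theorem exists_measurable_partition_injOn {g : ℝ → ℝ} {U : Set ℝ} (hU : MeasurableSet U)
    (h : ∀ x ∈ U, ∃ V : Set ℝ, IsOpen V ∧ x ∈ V ∧ Set.InjOn g V) :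
    ∃ A : ℕ → Set ℝ, (∀ n, MeasurableSet (A n)) ∧ Pairwise (Function.onFun Disjoint A) ∧
      (∀ n, Set.InjOn g (A n)) ∧ ⋃ n, A n = U := by
  classical
  choose! V hVo hxV hVinj using h
  -- Lindelöf: countably many of the neighbourhoods already cover `U`.
  obtain ⟨t, htU, htc, hcov⟩ := TopologicalSpace.countable_cover_nhdsWithin
    (s := U) (f := V) (fun x hx => mem_nhdsWithin_of_mem_nhds ((hVo x hx).mem_nhds (hxV x hx)))
  rcases t.eq_empty_or_nonempty with rfl | hne
  · refine ⟨fun _ => ∅, by simp, fun i j _ => by simp [Function.onFun], by simp, ?_⟩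
    simpa using (Set.subset_empty_iff.1 (by simpa using hcov) : U = ∅).symm
  · obtain ⟨e, rfl⟩ := htc.exists_eq_range hne
    have he : ∀ n, e n ∈ U := fun n => htU ⟨n, rfl⟩
    refine ⟨disjointed (fun n => V (e n) ∩ U), fun n => ?_, disjoint_disjointed _, fun n => ?_, ?_⟩
    · exact MeasurableSet.disjointed (fun n => ((hVo _ (he n)).measurableSet).inter hU) n
    · exact (hVinj _ (he n)).mono ((disjointed_subset _ n).trans Set.inter_subset_left)
    · rw [iUnion_disjointed, ← Set.iUnion_inter]
      refine Set.inter_eq_right.2 (hcov.trans ?_)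
      intro x hx
      simpa using hx

/-- The one-dimensional area formula: integrating the number of preimages. -/
theorem lintegral_encard_fiber_mul {g g' : ℝ → ℝ} (hg : ∀ x, HasDerivAt g (g' x) x)
    (hg' : Continuous g') {ψ : ℝ → ENNReal} (hψ : Measurable ψ) :
    ∫⁻ u, (({x | g x = u}.encard : ENat) : ENNReal) * ψ u
      = ∫⁻ x, ENNReal.ofReal |g' x| * ψ (g x) := by
  set U : Set ℝ := {x | g' x ≠ 0} with hUdef
  have hgc : Continuous g := continuous_iff_continuousAt.2 fun x => (hg x).continuousAt
  have hUo : IsOpen U := isOpen_ne_fun hg' continuous_const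
  have hloc : ∀ x ∈ U, ∃ V : Set ℝ, IsOpen V ∧ x ∈ V ∧ Set.InjOn g V := by
    intro x hx
    have hs : HasStrictDerivAt g (g' x) x :=
      hasStrictDerivAt_of_hasDerivAt_of_continuousAt (Filter.Eventually.of_forall hg)
        hg'.continuousAt
    have hs' := hs.hasStrictFDerivAt_equiv hx
    exact ⟨(hs'.toOpenPartialHomeomorph g).source, (hs'.toOpenPartialHomeomorph g).open_source,
      hs'.mem_toOpenPartialHomeomorph_source, (hs'.toOpenPartialHomeomorph g).injOn⟩
  obtain ⟨A, hAm, hAd, hAi, hAU⟩ := exists_measurable_partition_injOn hUo.measurableSet hloc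
  have himg : ∀ n, MeasurableSet (g '' A n) := fun n =>
    (hAm n).image_of_continuousOn_injOn hgc.continuousOn (hAi n)
  -- Sard in dimension one: critical values are null, so almost every fibre lies in `U`.
  have hcrit : volume (g '' Uᶜ) = 0 := by
    refine addHaar_image_eq_zero_of_det_fderivWithin_eq_zero (μ := volume)
      (f' := fun x => ContinuousLinearMap.toSpanSingleton ℝ (g' x))
      (fun x _ => (hg x).hasFDerivAt.hasFDerivWithinAt) ?_
    intro x hx
    have : g' x = 0 := by simpa [hUdef] using hx
    simp [this, ContinuousLinearMap.det]
  -- Injectivity on `A n` means that each piece contributes one point to the fibre or none.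
  have hcount : ∀ u, u ∉ g '' Uᶜ →
      (({x | g x = u}.encard : ENat) : ENNReal) = ∑' n, (g '' A n).indicator 1 u := by
    intro u hu
    have hfib : {x | g x = u} = ⋃ n, ({x | g x = u} ∩ A n) := by
      rw [← Set.inter_iUnion, hAU, eq_comm, Set.inter_eq_left]
      intro x hx
      by_contra hxU
      exact hu ⟨x, hxU, hx⟩
    have hfm : MeasurableSet {x | g x = u} := (isClosed_eq hgc continuous_const).measurableSet
    rw [← Measure.count_apply hfm, hfib, measure_iUnion
      (fun i j hij => (hAd hij).mono Set.inter_subset_right Set.inter_subset_right)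
      (fun n => hfm.inter (hAm n))]
    refine tsum_congr fun n => ?_
    by_cases hn : u ∈ g '' A n
    · obtain ⟨x, hx, hxu⟩ := hn
      have : {x | g x = u} ∩ A n = {x} := by
        ext y
        constructor
        · rintro ⟨hy, hyA⟩
          exact hAi n hyA hx ((show g y = u from hy).trans hxu.symm)
        · rintro rfl
          exact ⟨hxu, hx⟩
      rw [this, Measure.count_singleton, Set.indicator_of_mem (show u ∈ g '' A n from ⟨x, hx, hxu⟩)]
      rfl
    · have : {x | g x = u} ∩ A n = ∅ := by
        ext y
        simp only [Set.mem_inter_iff, Set.mem_ofPred_eq, Set.mem_empty_iff_false, iff_false, not_and]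
        exact fun hy hyA => hn ⟨y, hyA, hy⟩
      rw [this, measure_empty, Set.indicator_of_notMem hn]
  calc ∫⁻ u, (({x | g x = u}.encard : ENat) : ENNReal) * ψ u
      = ∫⁻ u, ∑' n, (g '' A n).indicator ψ u := by
        refine lintegral_congr_ae ?_
        filter_upwards [compl_mem_ae_iff.2 hcrit] with u hu
        rw [hcount u hu, ← ENNReal.tsum_mul_right]
        refine tsum_congr fun n => ?_
        by_cases hn : u ∈ g '' A n <;> simp [hn]
    _ = ∑' n, ∫⁻ u in g '' A n, ψ u := by
        rw [lintegral_tsum fun n => (hψ.indicator (himg n)).aemeasurable]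
        exact tsum_congr fun n => lintegral_indicator (himg n) _
    _ = ∑' n, ∫⁻ x in A n, ENNReal.ofReal |g' x| * ψ (g x) := tsum_congr fun n =>
        lintegral_image_eq_lintegral_abs_deriv_mul (hAm n)
          (fun x _ => (hg x).hasDerivWithinAt) (hAi n) ψ
    _ = ∫⁻ x in U, ENNReal.ofReal |g' x| * ψ (g x) := by
        rw [← hAU, lintegral_iUnion hAm hAd]
    _ = ∫⁻ x, ENNReal.ofReal |g' x| * ψ (g x) := by
        refine setLIntegral_eq_of_support_subset ?_
        intro x hx hx'
        simp [hx'] at hx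

/-! ### Measurability of the number of zeros. -/

theorem exists_rat_Icc_subset_of_isOpen {U : Set ℝ} (hU : IsOpen U) {x : ℝ} (hx : x ∈ U) :
    ∃ p : ℚ × ℚ, x ∈ Set.Icc (p.1 : ℝ) p.2 ∧ Set.Icc (p.1 : ℝ) p.2 ⊆ U := by
  obtain ⟨ε, hε, hball⟩ := Metric.isOpen_iff.1 hU x hx
  obtain ⟨p, hp1, hp2⟩ := exists_rat_btwn (show x - ε < x by linarith)
  obtain ⟨q, hq1, hq2⟩ := exists_rat_btwn (show x < x + ε by linarith)
  refine ⟨(p, q), ⟨hp2.le, hq1.le⟩, fun y hy => hball ?_⟩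
  rw [Metric.mem_ball, Real.dist_eq, abs_lt]
  constructor <;> linarith [hy.1, hy.2]

/-- Rational intervals separating the points make "at least k zeros" a countable union of events
about single intervals. -/
theorem natCast_le_encard_iff_exists_disjoint_Icc (s : Set ℝ) (k : ℕ) :
    (k : ℕ∞) ≤ s.encard ↔ ∃ I : Fin k → ℚ × ℚ,
      (Pairwise fun i j => Disjoint (Set.Icc ((I i).1 : ℝ) (I i).2) (Set.Icc ((I j).1 : ℝ) (I j).2)) ∧
      ∀ i, ∃ x ∈ Set.Icc ((I i).1 : ℝ) (I i).2, x ∈ s := by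
  constructor
  · intro h
    obtain ⟨t, hts, htk⟩ := Set.exists_subset_encard_eq h
    have htf : t.Finite := Set.finite_of_encard_eq_coe htk
    obtain ⟨V, hV, hVd⟩ := htf.t2_separation
    have hcard : htf.toFinset.card = k := by
      have := htf.encard_eq_coe_toFinset_card
      rw [htk] at this
      exact_mod_cast this.symm
    let e := htf.toFinset.equivFinOfCardEq hcard
    have he : ∀ i, ((e.symm i : ℝ)) ∈ t := fun i => htf.mem_toFinset.1 (e.symm i).2
    choose I hxI hIV using fun i => exists_rat_Icc_subset_of_isOpen (hV (e.symm i)).2 (hV (e.symm i)).1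
    refine ⟨I, fun i j hij => ?_, fun i => ⟨_, hxI i, hts (he i)⟩⟩
    refine (hVd (he i) (he j) fun h => hij ?_).mono (hIV i) (hIV j)
    exact e.symm.injective (Subtype.ext h)
  · rintro ⟨I, hI, hx⟩
    choose x hxI hxs using hx
    have hinj : Function.Injective x := by
      intro i j hij
      by_contra hne
      exact Set.disjoint_left.1 (hI hne) (hxI i) (hij ▸ hxI j)
    calc (k : ℕ∞) = (Set.range x).encard := by
          rw [← Set.image_univ, hinj.encard_image, Set.encard_univ]; simp
      _ ≤ s.encard := Set.encard_le_encard (Set.range_subset_iff.2 hxs)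

/-- Projection along the compact factor `Icc p q` is a closed map. -/
theorem isClosed_setOf_exists_mem_Icc_zero {E : Type*} [TopologicalSpace E] {f : E → ℝ → ℝ}
    (hf : Continuous (Function.uncurry f)) (p q : ℝ) :
    IsClosed {a | ∃ x ∈ Set.Icc p q, f a x = 0} := by
  have hcl : IsClosed {z : E × Set.Icc p q | f z.1 z.2 = 0} :=
    isClosed_eq (hf.comp (continuous_fst.prodMk (continuous_subtype_val.comp continuous_snd)))
      continuous_const
  convert isClosedMap_fst_of_compactSpace _ hcl using 1
  ext a
  simp

/-- The number of zeros of a jointly continuous family of real functions is measurable. -/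
theorem measurable_ncard_zeros {E : Type*} [TopologicalSpace E] [MeasurableSpace E]
    [OpensMeasurableSpace E] {f : E → ℝ → ℝ} (hf : Continuous (Function.uncurry f)) :
    Measurable fun a => {x | f a x = 0}.ncard := by
  have hle : ∀ k : ℕ, MeasurableSet {a | (k : ℕ∞) ≤ {x | f a x = 0}.encard} := by
    intro k
    have heq : {a | (k : ℕ∞) ≤ {x | f a x = 0}.encard} = ⋃ I : Fin k → ℚ × ℚ,
        {_a : E | Pairwise fun i j =>
          Disjoint (Set.Icc ((I i).1 : ℝ) (I i).2) (Set.Icc ((I j).1 : ℝ) (I j).2)} ∩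
        ⋂ i, {a | ∃ x ∈ Set.Icc ((I i).1 : ℝ) (I i).2, f a x = 0} := by
      ext a
      rw [Set.mem_ofPred_eq, natCast_le_encard_iff_exists_disjoint_Icc]
      simp only [Set.mem_iUnion, Set.mem_inter_iff, Set.mem_iInter, Set.mem_ofPred_eq]
    rw [heq]
    exact MeasurableSet.iUnion fun I => (MeasurableSet.const _).inter (MeasurableSet.iInter fun i =>
      (isClosed_setOf_exists_mem_Icc_zero hf _ _).measurableSet)
  have henc : Measurable fun a => {x | f a x = 0}.encard := by
    refine measurable_to_countable' fun m => ?_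
    induction m using ENat.recTopCoe with
    | top =>
      convert MeasurableSet.iInter hle using 1
      ext a
      simp only [Set.mem_preimage, Set.mem_singleton_iff, Set.mem_iInter, Set.mem_ofPred_eq]
      exact ⟨fun h k => h ▸ le_top, fun h => ENat.eq_top_iff_forall_ge.2 h⟩
    | coe m =>
      convert (hle m).diff (hle (m + 1)) using 1
      ext a
      simp only [Set.mem_preimage, Set.mem_singleton_iff, Set.mem_sdiff, Set.mem_ofPred_eq, not_le]
      push_cast
      rw [ENat.lt_add_one_iff (ENat.natCast_ne_top m)]
      exact ⟨fun h => ⟨h.ge, h.le⟩, fun h => le_antisymm h.2 h.1⟩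
  exact (measurable_from_top (f := ENat.toNat)).comp henc

/-! ### Gaussian integrals. -/

theorem integral_abs_gaussianReal (v : NNReal) :
    ∫ x, |x| ∂gaussianReal 0 v = √(2 * v / Real.pi) := by
  rcases eq_or_ne v 0 with rfl | hv
  · simp
  have hv0 : (0 : ℝ) < v := by positivity
  have hb : (0 : ℝ) < (2 * (v : ℝ))⁻¹ := by positivity
  rw [integral_gaussianReal_eq_integral_smul hv]
  have h1 : ∀ x : ℝ, gaussianPDFReal 0 v x • |x|
      = (√(2 * Real.pi * v))⁻¹ * (|x| ^ (1 : ℝ) * Real.exp (-(2 * (v : ℝ))⁻¹ * |x| ^ (2 : ℝ))) := by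
    intro x
    rw [gaussianPDFReal, smul_eq_mul, Real.rpow_one, Real.rpow_two, sq_abs, sub_zero]
    rw [show -x ^ 2 / (2 * (v : ℝ)) = -(2 * (v : ℝ))⁻¹ * x ^ 2 by field_simp]
    ring
  simp_rw [h1]
  rw [integral_const_mul, integral_comp_abs
      (f := fun y => y ^ (1 : ℝ) * Real.exp (-(2 * (v : ℝ))⁻¹ * y ^ (2 : ℝ))),
    integral_rpow_mul_exp_neg_mul_rpow two_pos (by norm_num) hb]
  norm_num
  rw [Real.rpow_neg_one]
  have h2 : √(v : ℝ) ≠ 0 := (Real.sqrt_pos.2 hv0).ne'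
  have h3 := Real.sq_sqrt hv0.le
  field_simp
  rw [h3, Real.sq_sqrt zero_le_two, mul_comm]

theorem lintegral_abs_gaussianReal (v : NNReal) :
    ∫⁻ x, ENNReal.ofReal |x| ∂gaussianReal 0 v = ENNReal.ofReal √(2 * v / Real.pi) := by
  rw [← integral_abs_gaussianReal, ofReal_integral_eq_lintegral_ofReal _ (ae_of_all _ abs_nonneg)]
  exact (memLp_one_iff_integrable.1 (memLp_id_gaussianReal' 1 (by simp))).abs

/-- Precisions add: 1/v + 1 = (1 + v)/v. -/
theorem gaussianPDF_mul_gaussianPDF {v : NNReal} (hv : v ≠ 0) (x : ℝ) :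
    gaussianPDF 0 v x * gaussianPDF 0 1 x
      = ENNReal.ofReal (√(2 * Real.pi * (1 + v)))⁻¹ * gaussianPDF 0 (v / (1 + v)) x := by
  have hv0 : (0 : ℝ) < v := by positivity
  simp only [gaussianPDF]
  rw [← ENNReal.ofReal_mul (gaussianPDFReal_nonneg _ _ _), ← ENNReal.ofReal_mul (by positivity)]
  congr 1
  simp only [gaussianPDFReal, NNReal.coe_div, NNReal.coe_add, NNReal.coe_one, sub_zero]
  have h2 : (√(2 * Real.pi * v))⁻¹ * (√(2 * Real.pi * 1))⁻¹
      = (√(2 * Real.pi * (1 + v)))⁻¹ * (√(2 * Real.pi * (v / (1 + v))))⁻¹ := by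
    rw [← mul_inv, ← mul_inv, ← Real.sqrt_mul (by positivity), ← Real.sqrt_mul (by positivity)]
    congr 2
    field_simp
  have h3 : Real.exp (-x ^ 2 / (2 * v)) * Real.exp (-x ^ 2 / (2 * 1))
      = Real.exp (-x ^ 2 / (2 * (v / (1 + v)))) := by
    rw [← Real.exp_add]
    congr 1
    field_simp
    ring
  calc _ = ((√(2 * Real.pi * v))⁻¹ * (√(2 * Real.pi * 1))⁻¹) *
        (Real.exp (-x ^ 2 / (2 * v)) * Real.exp (-x ^ 2 / (2 * 1))) := by ring
    _ = _ := by rw [h2, h3]; ring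

theorem lintegral_mul_gaussianPDF_gaussianReal {v : NNReal} (hv : v ≠ 0) {F : ℝ → ENNReal}
    (hF : Measurable F) :
    ∫⁻ x, F x * gaussianPDF 0 1 x ∂gaussianReal 0 v
      = ENNReal.ofReal (√(2 * Real.pi * (1 + v)))⁻¹ * ∫⁻ x, F x ∂gaussianReal 0 (v / (1 + v)) := by
  have hv' : v / (1 + v) ≠ 0 := by positivity
  rw [gaussianReal_of_var_ne_zero _ hv, gaussianReal_of_var_ne_zero _ hv',
    lintegral_withDensity_eq_lintegral_mul _ (measurable_gaussianPDF _ _)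
      (show Measurable fun x => F x * gaussianPDF 0 1 x from hF.mul (measurable_gaussianPDF _ _)),
    lintegral_withDensity_eq_lintegral_mul _ (measurable_gaussianPDF _ _) hF,
    ← lintegral_const_mul _ ((measurable_gaussianPDF _ _).mul hF)]
  refine lintegral_congr fun x => ?_
  simp only [Pi.mul_apply]
  rw [← mul_assoc (ENNReal.ofReal _), ← gaussianPDF_mul_gaussianPDF hv]
  ring

theorem lintegral_abs_mul_add_prod_gaussianReal (β : ℝ) (v w : NNReal) :
    ∫⁻ z, ENNReal.ofReal |β * z.1 + z.2| ∂(gaussianReal 0 v).prod (gaussianReal 0 w)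
      = ENNReal.ofReal √(2 * (β ^ 2 * v + w) / Real.pi) := by
  have hX : ((gaussianReal 0 v).prod (gaussianReal 0 w)).map (fun z => β * z.1)
      = gaussianReal 0 (NNReal.mk (β ^ 2) (sq_nonneg _) * v) := by
    rw [show (fun z : ℝ × ℝ => β * z.1) = (fun x => β * x) ∘ Prod.fst from rfl,
      ← Measure.map_map (by fun_prop) measurable_fst, Measure.map_fst_prod]
    simp [gaussianReal_map_const_mul]
  have hZ : ((gaussianReal 0 v).prod (gaussianReal 0 w)).map Prod.snd = gaussianReal 0 w := by
    rw [Measure.map_snd_prod]; simp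
  have hind : IndepFun (fun z : ℝ × ℝ => β * z.1) Prod.snd
      ((gaussianReal 0 v).prod (gaussianReal 0 w)) :=
    indepFun_prod (X := fun x => β * x) (Y := id) (by fun_prop) measurable_id
  have hsum := gaussianReal_add_gaussianReal_of_indepFun hind hX hZ
  have hmeas : Measurable fun x : ℝ => ENNReal.ofReal |x| := by fun_prop
  have h := lintegral_map hmeas (show Measurable ((fun z : ℝ × ℝ => β * z.1) + Prod.snd) by fun_prop)
    (μ := (gaussianReal 0 v).prod (gaussianReal 0 w))
  rw [hsum, add_zero, lintegral_abs_gaussianReal] at h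
  refine h.symm.trans ?_
  simp

/-- For a centred Gaussian vector `(X, Y)` this is the mean of `|Y|` weighted by the standard normal
density at `X`. -/
theorem lintegral_abs_mul_gaussianPDF_of_hasGaussianLaw {Ω : Type*} [MeasurableSpace Ω]
    {P : Measure Ω} {X Y : Ω → ℝ} (h : HasGaussianLaw (fun ω => (X ω, Y ω)) P)
    (hX : P[X] = 0) (hY : P[Y] = 0) (hv : Var[X; P] ≠ 0) :
    ∫⁻ ω, ENNReal.ofReal |Y ω| * gaussianPDF 0 1 (X ω) ∂P
      = ENNReal.ofReal (√(Var[Y; P] * (1 + Var[X; P]) - cov[X, Y; P] ^ 2)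
          / (Real.pi * (1 + Var[X; P]))) := by
  have hprob := h.isProbabilityMeasure
  set s := Var[X; P] with hs
  set c := cov[X, Y; P] with hc
  -- Regression coefficient of `Y` on `X`: the residual `Y - β X` is uncorrelated with `X`, hence
  -- independent of it by joint Gaussianity.
  set β := c / s with hβ
  have hs0 : 0 < s := lt_of_le_of_ne (variance_nonneg _ _) (Ne.symm hv)
  have hXL := h.fst.memLp_two
  have hYL := h.snd.memLp_two
  have hXZ : HasGaussianLaw (fun ω => (X ω, Y ω - β * X ω)) P := by
    have := h.map_fun ((ContinuousLinearMap.fst ℝ ℝ ℝ).prod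
      (ContinuousLinearMap.snd ℝ ℝ ℝ - β • ContinuousLinearMap.fst ℝ ℝ ℝ))
    simpa using this
  have hβX : MemLp (fun ω => β * X ω) 2 P := hXL.const_mul β
  have hcov : cov[X, fun ω => Y ω - β * X ω; P] = 0 := by
    rw [covariance_fun_sub_right hXL hYL hβX, covariance_const_mul_right,
      covariance_self h.fst.aemeasurable, ← hs, ← hc, hβ]
    field_simp
    ring
  have hind := hXZ.indepFun_of_covariance_eq_zero hcov
  have hVarZ : Var[fun ω => Y ω - β * X ω; P] = Var[Y; P] - c ^ 2 / s := by
    rw [variance_fun_sub hYL hβX, variance_const_mul, covariance_const_mul_right,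
      covariance_comm, ← hs, ← hc, hβ]
    field_simp
    ring
  have hEZ : P[fun ω => Y ω - β * X ω] = 0 := by
    rw [integral_sub h.snd.integrable (h.fst.integrable.const_mul _), integral_const_mul, hX, hY]
    simp
  have hmX := h.fst.map_eq_gaussianReal
  have hmZ := hXZ.snd.map_eq_gaussianReal
  rw [hX] at hmX
  rw [hEZ, hVarZ] at hmZ
  set v := s.toNNReal with hvdef
  set w := (Var[Y; P] - c ^ 2 / s).toNNReal with hwdef
  have hvs : (v : ℝ) = s := Real.coe_toNNReal _ hs0.le
  have hws : (w : ℝ) = Var[Y; P] - c ^ 2 / s :=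
    Real.coe_toNNReal _ (by rw [← hVarZ]; exact variance_nonneg _ _)
  have hv0 : v ≠ 0 := by
    intro h0
    rw [h0] at hvs
    exact hv hvs.symm
  have hjoint := (indepFun_iff_map_prod_eq_prod_map_map h.fst.aemeasurable
    hXZ.snd.aemeasurable).1 hind
  rw [hmX, hmZ] at hjoint
  have hFm : Measurable fun z : ℝ × ℝ => ENNReal.ofReal |β * z.1 + z.2| := by fun_prop
  have hFm' : Measurable fun z : ℝ × ℝ =>
      ENNReal.ofReal |β * z.1 + z.2| * gaussianPDF 0 1 z.1 :=
    hFm.mul ((measurable_gaussianPDF 0 1).comp measurable_fst)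
  calc ∫⁻ ω, ENNReal.ofReal |Y ω| * gaussianPDF 0 1 (X ω) ∂P
      = ∫⁻ z, ENNReal.ofReal |β * z.1 + z.2| * gaussianPDF 0 1 z.1
          ∂(gaussianReal 0 v).prod (gaussianReal 0 w) := by
        rw [← hjoint, lintegral_map' hFm'.aemeasurable hXZ.aemeasurable]
        refine lintegral_congr fun ω => ?_
        simp
    -- The density weight is absorbed by shrinking the variance of the first factor from v to v/(1 +
    -- v).
    _ = ENNReal.ofReal (√(2 * Real.pi * (1 + v)))⁻¹ *
          ∫⁻ z, ENNReal.ofReal |β * z.1 + z.2|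
            ∂(gaussianReal 0 (v / (1 + v))).prod (gaussianReal 0 w) := by
        rw [lintegral_prod_symm' _ hFm', lintegral_prod_symm' _ hFm, ← lintegral_const_mul]
        · refine lintegral_congr fun y => ?_
          exact lintegral_mul_gaussianPDF_gaussianReal hv0 (F := fun x => ENNReal.ofReal |β * x + y|)
            (by fun_prop)
        · exact hFm.lintegral_prod_left'
    _ = _ := by
        rw [lintegral_abs_mul_add_prod_gaussianReal, ← ENNReal.ofReal_mul (by positivity)]
        congr 1
        have hπ := Real.pi_pos
        rw [NNReal.coe_div, NNReal.coe_add, NNReal.coe_one, hvs, hws]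
        have hs1 : 0 < 1 + s := by positivity
        have e1 : 2 * (β ^ 2 * (s / (1 + s)) + (Var[Y; P] - c ^ 2 / s)) / Real.pi
            = (Var[Y; P] * (1 + s) - c ^ 2) * (2 / (Real.pi * (1 + s))) := by
          rw [hβ]; field_simp; ring
        have e2 : 2 / (Real.pi * (1 + s)) = (2 * Real.pi * (1 + s)) / (Real.pi * (1 + s)) ^ 2 := by
          field_simp
        rw [e1, e2, Real.sqrt_mul' (Var[Y; P] * (1 + s) - c ^ 2) (by positivity),
          Real.sqrt_div' _ (sq_nonneg _), Real.sqrt_sq (by positivity)]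
        have : √(2 * Real.pi * (1 + s)) ≠ 0 := by positivity
        field_simp

/-! ### Closed forms of the even binomial sums. -/

theorem sum_range_two_mul_add_one {M : Type*} [AddCommMonoid M] (f : ℕ → M) (d : ℕ) :
    ∑ j ∈ Finset.range (2 * d + 1), f j
      = ∑ k ∈ Finset.range (d + 1), f (2 * k) + ∑ k ∈ Finset.range d, f (2 * k + 1) := by
  induction d with
  | zero => simp
  | succ d ih =>
    rw [show 2 * (d + 1) + 1 = 2 * d + 1 + 1 + 1 by ring, Finset.sum_range_succ,
      Finset.sum_range_succ, ih, Finset.sum_range_succ (fun k => f (2 * k)) (d + 1),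
      Finset.sum_range_succ (fun k => f (2 * k + 1)) d, show 2 * (d + 1) = 2 * d + 1 + 1 by ring]
    abel

/-- The odd terms cancel between the expansions at y and -y. At y = x² the sum is the variance of
P_d(x). -/
theorem sum_choose_two_mul_pow (d : ℕ) (y : ℝ) :
    ∑ k ∈ Finset.range (d + 1), ((2 * d).choose (2 * k) : ℝ) * y ^ (2 * k)
      = ((1 + y) ^ (2 * d) + (1 - y) ^ (2 * d)) / 2 := by
  have h : ∀ y : ℝ, (1 + y) ^ (2 * d)
      = ∑ k ∈ Finset.range (d + 1), ((2 * d).choose (2 * k) : ℝ) * y ^ (2 * k)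
        + ∑ k ∈ Finset.range d, ((2 * d).choose (2 * k + 1) : ℝ) * y ^ (2 * k + 1) := by
    intro y
    rw [add_comm 1 y, add_pow,
      ← sum_range_two_mul_add_one fun j => ((2 * d).choose j : ℝ) * y ^ j]
    refine Finset.sum_congr rfl fun j _ => ?_
    simp [mul_comm]
  have h2 := h (-y)
  have e1 : ∀ k : ℕ, (-y) ^ (2 * k) = y ^ (2 * k) := fun k => by
    rw [pow_mul, pow_mul, neg_sq]
  have e2 : ∀ k : ℕ, (-y) ^ (2 * k + 1) = -y ^ (2 * k + 1) := fun k => by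
    rw [pow_succ, e1, pow_succ]; ring
  simp only [e1, e2, mul_neg, Finset.sum_neg_distrib] at h2
  rw [sub_eq_add_neg, h y, h2]
  ring

/-- The Euler operator `y d/dy` applied to an even polynomial. -/
theorem sum_mul_two_mul_pow_of_hasDerivAt {s : Finset ℕ} {c : ℕ → ℝ} {G G' : ℝ → ℝ}
    (hG : ∀ y, ∑ k ∈ s, c k * y ^ (2 * k) = G y) (hG' : ∀ y, HasDerivAt G (G' y) y) (y : ℝ) :
    ∑ k ∈ s, c k * (2 * k) * y ^ (2 * k) = y * G' y := by
  have h1 : HasDerivAt G (∑ k ∈ s, c k * (((2 * k : ℕ) : ℝ) * y ^ (2 * k - 1))) y := by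
    rw [← funext hG]
    exact HasDerivAt.fun_sum fun k _ => (hasDerivAt_pow (2 * k) y).const_mul (c k)
  rw [← h1.unique (hG' y), Finset.mul_sum]
  refine Finset.sum_congr rfl fun k _ => ?_
  -- At k = 0 the truncated exponent 2k - 1 is 0, but the factor 2k vanishes.
  rcases k with _ | k
  · simp
  · rw [show 2 * (k + 1) - 1 = 2 * k + 1 by omega, show 2 * (k + 1) = 2 * k + 1 + 1 by ring]
    push_cast
    ring

theorem sum_choose_mul_two_mul_pow (m : ℕ) (y : ℝ) :
    ∑ k ∈ Finset.range (m + 2), ((2 * (m + 1)).choose (2 * k) : ℝ) * (2 * k) * y ^ (2 * k)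
      = y * ((m + 1) * ((1 + y) ^ (2 * m + 1) - (1 - y) ^ (2 * m + 1))) := by
  refine sum_mul_two_mul_pow_of_hasDerivAt (G := fun y => ((1 + y) ^ (2 * (m + 1))
    + (1 - y) ^ (2 * (m + 1))) / 2)
    (G' := fun y => (m + 1) * ((1 + y) ^ (2 * m + 1) - (1 - y) ^ (2 * m + 1)))
    (sum_choose_two_mul_pow (m + 1)) (fun y => ?_) y
  have h1 := ((hasDerivAt_id y).const_add 1).pow (2 * (m + 1))
  have h2 := ((hasDerivAt_id y).const_sub 1).pow (2 * (m + 1))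
  refine ((h1.add h2).div_const 2).congr_deriv ?_
  rw [show 2 * (m + 1) - 1 = 2 * m + 1 by omega]
  push_cast
  simp only [id]
  ring

theorem sum_choose_mul_two_mul_sq_pow (m : ℕ) (y : ℝ) :
    ∑ k ∈ Finset.range (m + 2), ((2 * (m + 1)).choose (2 * k) : ℝ) * (2 * k) * (2 * k) * y ^ (2 * k)
      = y * ((m + 1) * ((1 + y) ^ (2 * m + 1) - (1 - y) ^ (2 * m + 1))
        + y * ((m + 1) * (2 * m + 1) * ((1 + y) ^ (2 * m) + (1 - y) ^ (2 * m)))) := by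
  refine sum_mul_two_mul_pow_of_hasDerivAt
    (G' := fun y => (m + 1) * ((1 + y) ^ (2 * m + 1) - (1 - y) ^ (2 * m + 1))
        + y * ((m + 1) * (2 * m + 1) * ((1 + y) ^ (2 * m) + (1 - y) ^ (2 * m))))
    (sum_choose_mul_two_mul_pow m) (fun y => ?_) y
  have h1 := ((hasDerivAt_id y).const_add 1).pow (2 * m + 1)
  have h2 := ((hasDerivAt_id y).const_sub 1).pow (2 * m + 1)
  refine ((hasDerivAt_id y).mul ((h1.sub h2).const_mul ((m : ℝ) + 1))).congr_deriv ?_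
  simp only [id, Pi.sub_apply, Pi.pow_apply, Nat.add_sub_cancel]
  push_cast
  ring

/-! ### Comparison of the root density with the Cauchy profile. -/

/-- Bernoulli's inequality bounds the growing factors by powers of 1 + z or 1 + z/2, which (1 -
z)^(m+1) or (1 - z)^m outweighs. The second term is quadratic in m z, hence the square in `hB`,
where (1 - z)(1 + z/2)² = 1 - 3z²/4 - z³/4 ≤ 1. The constant is 12 = 4 + 8. -/
theorem four_mul_pow_add_mul_pow_le (m : ℕ) {z : ℝ} (h0 : 0 ≤ z) (h1 : z ≤ 1) :
    (4 * (1 - z) ^ (m + 1) + (2 * m + 1) * z * (1 - z) ^ m) * (1 + (m + 1) * z) ≤ 12 := by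
  have hq : 0 ≤ 1 - z := by linarith
  have hA : (1 - z) ^ (m + 1) * (1 + (m + 1) * z) ≤ 1 := by
    have hb : 1 + ((m : ℝ) + 1) * z ≤ (1 + z) ^ (m + 1) := by
      have := one_add_mul_le_pow (show -2 ≤ z by linarith) (m + 1)
      push_cast at this
      exact this
    calc (1 - z) ^ (m + 1) * (1 + (m + 1) * z) ≤ (1 - z) ^ (m + 1) * (1 + z) ^ (m + 1) := by gcongr
      _ = (1 - z ^ 2) ^ (m + 1) := by rw [← mul_pow]; ring
      _ ≤ 1 := pow_le_one₀ (by nlinarith) (by nlinarith)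
  have hB : (1 - z) ^ m * (1 + m * (z / 2)) ^ 2 ≤ 1 := by
    have hb : 1 + (m : ℝ) * (z / 2) ≤ (1 + z / 2) ^ m :=
      one_add_mul_le_pow (by linarith) m
    calc (1 - z) ^ m * (1 + m * (z / 2)) ^ 2 ≤ (1 - z) ^ m * ((1 + z / 2) ^ m) ^ 2 := by gcongr
      _ = ((1 - z) * (1 + z / 2) ^ 2) ^ m := by rw [mul_pow, ← pow_mul, ← pow_mul, mul_comm m 2]
      _ ≤ 1 := pow_le_one₀ (by positivity) (by nlinarith [pow_nonneg h0 3])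
  have hm : (0 : ℝ) ≤ m := m.cast_nonneg
  have hmz : 0 ≤ m * z := by positivity
  have hC : (2 * m + 1) * z * (1 + (m + 1) * z) ≤ 8 * (1 + m * (z / 2)) ^ 2 := by nlinarith
  have hR : 0 ≤ (1 - z) ^ m := by positivity
  nlinarith [mul_le_mul_of_nonneg_left hC hR]

/-- The quantity 4y/(1 + y)² is of order y near 0 and 1/y near infinity; the two summands handle y ≤
1 and y ≥ 1, and both have explicit integrals after y = x². -/
theorem inv_mul_inv_le_add_inv {d y : ℝ} (hd : 0 < d) (hy : 0 ≤ y) :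
    (1 + y)⁻¹ * (1 + d * (4 * y / (1 + y) ^ 2))⁻¹ ≤ (1 + d * y)⁻¹ + (y + d)⁻¹ := by
  have hp : 0 < 1 + y := by linarith
  have e : (1 + y)⁻¹ * (1 + d * (4 * y / (1 + y) ^ 2))⁻¹
      = (1 + y) / ((1 + y) ^ 2 + 4 * d * y) := by
    field_simp
  have h1 : 0 < 1 + d * y := by positivity
  have h2 : 0 < y + d := by positivity
  have h3 : 0 < (1 + y) ^ 2 + 4 * d * y := by positivity
  have hdy : 0 ≤ d * y := by positivity
  rw [e]
  rcases le_total y 1 with h | h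
  · refine le_add_of_le_of_nonneg ?_ (by positivity)
    rw [inv_eq_one_div, div_le_div_iff₀ h3 h1]
    nlinarith
  · refine le_add_of_nonneg_of_le (by positivity) ?_
    rw [inv_eq_one_div, div_le_div_iff₀ h3 h2]
    nlinarith

theorem abs_sqrt_sub_one_le {H : ℝ} (hH : 0 ≤ H) : |√H - 1| ≤ |H - 1| := by
  have h : H - 1 = (√H - 1) * (√H + 1) := by nlinarith [Real.sq_sqrt hH]
  rw [h, abs_mul]
  refine le_mul_of_one_le_right (abs_nonneg _) ?_
  rw [abs_of_nonneg (by positivity)]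
  linarith [Real.sqrt_nonneg H]

/-- `π` times the density at `x` of the expected number of real zeros of the random polynomial of
degree `2 (m + 1)`, as a function of `y = x ^ 2`. -/
noncomputable def zeroDensity (m : ℕ) (y : ℝ) : ℝ :=
  √((m + 1) / 2 * ((1 + y) ^ 2 * ((1 + y) ^ (2 * m)) ^ 2 - (1 - y) ^ 2 * ((1 - y) ^ (2 * m)) ^ 2
    + 4 * (2 * m + 1) * y * ((1 + y) ^ (2 * m) * (1 - y) ^ (2 * m))))
    / (((1 + y) ^ (2 * (m + 1)) + (1 - y) ^ (2 * (m + 1))) / 2)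

theorem abs_zeroDensity_sub_le (m : ℕ) {y : ℝ} (hy : 0 ≤ y) :
    |zeroDensity m y - √(2 * (m + 1)) * (1 + y)⁻¹|
      ≤ 12 * √(2 * (m + 1)) * ((1 + (m + 1) * y)⁻¹ + (y + (m + 1))⁻¹) := by
  set p := 1 + y with hp
  set q := 1 - y with hq
  have hp0 : 0 < p := by linarith
  set z := 4 * y / p ^ 2 with hz
  have hz0 : 0 ≤ z := by positivity
  have hr : 1 - z = (q / p) ^ 2 := by rw [hz, hq, hp]; rw [hp] at hp0; field_simp; ring
  have hz1 : z ≤ 1 := by linarith [hr, sq_nonneg (q / p)]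
  set R := (1 - z) ^ m with hR
  have hR0 : 0 ≤ R := pow_nonneg (by linarith) _
  have hR1 : R ≤ 1 := pow_le_one₀ (by linarith) (by linarith)
  set A := p ^ (2 * m) with hA
  have hA0 : 0 < A := by positivity
  -- The exponent is even, so the sign of 1 - y does not matter.
  have hB : q ^ (2 * m) = R * A := by
    rw [hR, hr, hA, ← pow_mul, div_pow]; field_simp
  have hq2 : q ^ 2 = (1 - z) * p ^ 2 := by rw [hr, div_pow]; field_simp
  have hyz : 4 * y = z * p ^ 2 := by rw [hz]; field_simp
  set S := (1 - z) * R with hS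
  have hS0 : 0 ≤ S := mul_nonneg (by linarith) hR0
  have hS1 : S ≤ 1 := mul_le_one₀ (by linarith) hR0 hR1
  -- The square of the ratio of `zeroDensity m y` to its main term √(2(m + 1))/(1 + y).
  set H := (1 - S * R + (2 * m + 1) * z * R) / (1 + S) ^ 2 with hH
  have hnum : 0 ≤ 1 - S * R + (2 * m + 1) * z * R := by
    have : S * R ≤ 1 := mul_le_one₀ hS1 hR0 hR1
    have : 0 ≤ (2 * m + 1) * z * R := by positivity
    linarith
  have hH0 : 0 ≤ H := by positivity
  have hden : zeroDensity m y = √(2 * (m + 1)) * p⁻¹ * √H := by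
    have e1 : ((m : ℝ) + 1) / 2 * (p ^ 2 * A ^ 2 - q ^ 2 * (R * A) ^ 2
        + 4 * (2 * m + 1) * y * (A * (R * A)))
        = (2 * (m + 1)) * H * (p * A * (1 + S) / 2) ^ 2 := by
      rw [hH, hq2, show 4 * (2 * (m : ℝ) + 1) * y = (2 * m + 1) * (z * p ^ 2) by rw [← hyz]; ring]
      field_simp
      rw [hS]
      ring
    have e2 : (p ^ (2 * (m + 1)) + q ^ (2 * (m + 1))) / 2 = p * (p * A * (1 + S) / 2) := by
      rw [mul_add, pow_add, pow_add, hB, ← hA, mul_one, hq2, hS]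
      ring
    unfold zeroDensity
    rw [← hp, ← hq, hB, ← hA, e1, e2, Real.sqrt_mul (by positivity), Real.sqrt_mul (by positivity),
      Real.sqrt_sq (by positivity)]
    field_simp
  have hH1 : |H - 1| ≤ 12 * (1 + (m + 1) * z)⁻¹ := by
    have h1 : |H - 1| ≤ 4 * S + (2 * m + 1) * z * R := by
      have e : H - 1 = (1 - S * R + (2 * m + 1) * z * R - (1 + S) ^ 2) / (1 + S) ^ 2 := by
        rw [hH]; field_simp
      have hzR : 0 ≤ (2 * m + 1) * z * R := by positivity
      have hSR : S * R ≤ S := mul_le_of_le_one_right hS0 hR1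
      have hSR0 : 0 ≤ S * R := mul_nonneg hS0 hR0
      rw [e, abs_div, abs_of_pos (show 0 < (1 + S) ^ 2 by positivity)]
      -- The denominator is at least 1, and in the numerator 2S + S² + SR ≤ 4S.
      refine (div_le_self (abs_nonneg _) (by nlinarith)).trans ?_
      rw [abs_le]
      constructor <;> nlinarith
    have h2 := four_mul_pow_add_mul_pow_le m hz0 hz1
    rw [pow_succ', ← hR, ← hS] at h2
    rw [← div_eq_mul_inv, le_div_iff₀ (by positivity)]
    exact (mul_le_mul_of_nonneg_right h1 (by positivity)).trans h2
  have hfin := inv_mul_inv_le_add_inv (show (0 : ℝ) < m + 1 by positivity) hy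
  rw [← hp, ← hz] at hfin
  calc |zeroDensity m y - √(2 * (m + 1)) * p⁻¹|
      = √(2 * (m + 1)) * p⁻¹ * |√H - 1| := by
        rw [hden, ← mul_sub_one, abs_mul, abs_of_nonneg (by positivity)]
    _ ≤ √(2 * (m + 1)) * p⁻¹ * (12 * (1 + (m + 1) * z)⁻¹) := by
        gcongr
        exact (abs_sqrt_sub_one_le hH0).trans hH1
    _ = 12 * √(2 * (m + 1)) * (p⁻¹ * (1 + (m + 1) * z)⁻¹) := by ring
    _ ≤ _ := by gcongr

theorem integral_inv_one_add_mul_sq {c : ℝ} (hc : 0 < c) :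
    Integrable (fun x : ℝ => (1 + c * x ^ 2)⁻¹) ∧ ∫ x : ℝ, (1 + c * x ^ 2)⁻¹ = Real.pi / √c := by
  have hs : √c ≠ 0 := (Real.sqrt_pos.2 hc).ne'
  have e : (fun x : ℝ => (1 + c * x ^ 2)⁻¹) = fun x => (1 + (√c * x) ^ 2)⁻¹ := by
    ext x
    rw [mul_pow, Real.sq_sqrt hc.le]
  rw [e]
  refine ⟨integrable_inv_one_add_sq.comp_mul_left' hs, ?_⟩
  rw [Measure.integral_comp_mul_left (fun x => (1 + x ^ 2)⁻¹), integral_univ_inv_one_add_sq,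
    abs_of_pos (by positivity), smul_eq_mul]
  field_simp

theorem integral_inv_sq_add {c : ℝ} (hc : 0 < c) :
    Integrable (fun x : ℝ => (x ^ 2 + c)⁻¹) ∧ ∫ x : ℝ, (x ^ 2 + c)⁻¹ = Real.pi / √c := by
  have h := integral_inv_one_add_mul_sq (inv_pos.2 hc)
  have e : (fun x : ℝ => (x ^ 2 + c)⁻¹) = fun x => c⁻¹ * (1 + c⁻¹ * x ^ 2)⁻¹ := by
    ext x
    rw [← mul_inv]
    congr 1
    field_simp
    ring
  rw [e]
  refine ⟨h.1.const_mul _, ?_⟩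
  rw [integral_const_mul, h.2, Real.sqrt_inv]
  have hs : √c ≠ 0 := (Real.sqrt_pos.2 hc).ne'
  field_simp
  rw [Real.sq_sqrt hc.le]

theorem zeroDensity_nonneg (m : ℕ) (y : ℝ) : 0 ≤ zeroDensity m y := by
  have h : ∀ x : ℝ, 0 ≤ x ^ (2 * (m + 1)) := fun x => by rw [pow_mul]; positivity
  exact div_nonneg (Real.sqrt_nonneg _) (div_nonneg (add_nonneg (h _) (h _)) zero_le_two)

/-- The two error terms integrate to π/√(m + 1) each, which cancels the growth of 12√(2(m + 1)) and
leaves 24π√2. -/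
theorem integral_zeroDensity (m : ℕ) :
    Integrable (fun x : ℝ => zeroDensity m (x ^ 2)) ∧
      |(∫ x : ℝ, zeroDensity m (x ^ 2)) - Real.pi * √(2 * (m + 1))| ≤ 24 * Real.pi * √2 := by
  set s := √(2 * ((m : ℝ) + 1)) with hs
  have hm : (0 : ℝ) < m + 1 := by positivity
  have hi1 := integral_inv_one_add_mul_sq hm
  have hi2 := integral_inv_sq_add hm
  have hbd : Integrable (fun x : ℝ => 12 * s * ((1 + (m + 1) * x ^ 2)⁻¹ + (x ^ 2 + (m + 1))⁻¹)) :=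
    (hi1.1.add hi2.1).const_mul _
  have hmain : Integrable (fun x : ℝ => s * (1 + x ^ 2)⁻¹) := integrable_inv_one_add_sq.const_mul s
  have hmeas : Measurable (fun x : ℝ => zeroDensity m (x ^ 2)) := by
    unfold zeroDensity
    fun_prop
  have hdiff : Integrable (fun x : ℝ => zeroDensity m (x ^ 2) - s * (1 + x ^ 2)⁻¹) :=
    hbd.mono' (hmeas.aestronglyMeasurable.sub hmain.aestronglyMeasurable)
      (ae_of_all _ fun x => abs_zeroDensity_sub_le m (sq_nonneg x))
  have hint : Integrable (fun x : ℝ => zeroDensity m (x ^ 2)) := by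
    exact (hdiff.add hmain).congr (ae_of_all _ fun x => by simp)
  refine ⟨hint, ?_⟩
  have e : Real.pi * s = ∫ x : ℝ, s * (1 + x ^ 2)⁻¹ := by
    rw [integral_const_mul, integral_univ_inv_one_add_sq, mul_comm]
  rw [e, ← integral_sub hint hmain]
  calc |∫ x : ℝ, (zeroDensity m (x ^ 2) - s * (1 + x ^ 2)⁻¹)|
      ≤ ∫ x : ℝ, 12 * s * ((1 + (m + 1) * x ^ 2)⁻¹ + (x ^ 2 + (m + 1))⁻¹) := by
        rw [← Real.norm_eq_abs]
        exact norm_integral_le_of_norm_le hbd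
          (ae_of_all _ fun x => abs_zeroDensity_sub_le m (sq_nonneg x))
    _ = 24 * Real.pi * √2 := by
        rw [integral_const_mul, integral_add hi1.1 hi2.1, hi1.2, hi2.2, hs,
          Real.sqrt_mul zero_le_two]
        have : √((m : ℝ) + 1) ≠ 0 := (Real.sqrt_pos.2 hm).ne'
        field_simp
        ring

/-! ### Linear forms in a standard Gaussian vector. -/

/-- The standard Gaussian measure on `ℝⁿ`. -/
noncomputable abbrev gaussianPi (n : ℕ) : Measure (Fin n → ℝ) :=
  Measure.pi fun _ => gaussianReal 0 1

theorem iIndepFun_eval_gaussianPi (n : ℕ) :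
    iIndepFun (fun (k : Fin n) (b : Fin n → ℝ) => b k) (gaussianPi n) :=
  iIndepFun_pi (X := fun _ => id) fun _ => aemeasurable_id

theorem hasGaussianLaw_linearForms {n : ℕ} (w v : Fin n → ℝ) :
    HasGaussianLaw (fun b => (∑ k, w k * b k, ∑ k, v k * b k)) (gaussianPi n) := by
  have h : HasGaussianLaw (fun b : Fin n → ℝ => fun k => b k) (gaussianPi n) :=
    (iIndepFun_eval_gaussianPi n).hasGaussianLaw fun k =>
      (measurePreserving_eval (fun _ : Fin n => gaussianReal 0 1) k).hasLaw.hasGaussianLaw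
  have := h.map_fun ((∑ k, w k • ContinuousLinearMap.proj (R := ℝ) (φ := fun _ : Fin n => ℝ) k).prod
    (∑ k, v k • ContinuousLinearMap.proj (R := ℝ) (φ := fun _ : Fin n => ℝ) k))
  simpa using this

theorem memLp_eval_gaussianPi {n : ℕ} (k : Fin n) :
    MemLp (fun b : Fin n → ℝ => b k) 2 (gaussianPi n) :=
  (memLp_id_gaussianReal 2).comp_measurePreserving
    (measurePreserving_eval (fun _ : Fin n => gaussianReal 0 1) k)

theorem integral_linearForm {n : ℕ} (w : Fin n → ℝ) :
    ∫ b, ∑ k, w k * b k ∂gaussianPi n = 0 := by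
  rw [integral_finsetSum _ fun k _ =>
    ((memLp_eval_gaussianPi k).integrable one_le_two).const_mul (w k)]
  refine Finset.sum_eq_zero fun k _ => ?_
  have h : ∫ b : Fin n → ℝ, b k ∂gaussianPi n = 0 := by
    rw [integral_comp_eval (μ := fun _ : Fin n => gaussianReal 0 1) (f := fun x => x)
      (by fun_prop)]
    exact integral_id_gaussianReal
  rw [integral_const_mul, h, mul_zero]

theorem covariance_eval_gaussianPi {n : ℕ} (i j : Fin n) :
    cov[fun b => b i, fun b => b j; gaussianPi n] = if i = j then 1 else 0 := by
  split_ifs with h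
  · subst h
    rw [covariance_self (memLp_eval_gaussianPi i).aemeasurable]
    have := (measurePreserving_eval (fun _ : Fin n => gaussianReal 0 1) i).hasLaw.variance_eq
    rw [variance_id_gaussianReal] at this
    simpa using this
  · exact ((iIndepFun_eval_gaussianPi n).indepFun h).covariance_eq_zero (memLp_eval_gaussianPi i)
      (memLp_eval_gaussianPi j)

theorem covariance_linearForms {n : ℕ} (w v : Fin n → ℝ) :
    cov[fun b => ∑ k, w k * b k, fun b => ∑ k, v k * b k; gaussianPi n] = ∑ k, w k * v k := by
  rw [covariance_fun_sum_fun_sum (fun k => (memLp_eval_gaussianPi k).const_mul (w k))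
    (fun k => (memLp_eval_gaussianPi k).const_mul (v k))]
  refine Finset.sum_congr rfl fun i _ => ?_
  simp [covariance_const_mul_left, covariance_const_mul_right, covariance_eval_gaussianPi, mul_comm]

theorem lintegral_linearForms {n : ℕ} (w v : Fin n → ℝ) (hw : ∑ k, w k * w k ≠ 0) :
    ∫⁻ b, ENNReal.ofReal |∑ k, v k * b k| * gaussianPDF 0 1 (∑ k, w k * b k) ∂gaussianPi n
      = ENNReal.ofReal (√((∑ k, v k * v k) * (1 + ∑ k, w k * w k) - (∑ k, w k * v k) ^ 2)
          / (Real.pi * (1 + ∑ k, w k * w k))) := by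
  have hvar : ∀ u : Fin n → ℝ, Var[fun b => ∑ k, u k * b k; gaussianPi n] = ∑ k, u k * u k :=
    fun u => by rw [← covariance_linearForms, covariance_self (Measurable.aemeasurable (by fun_prop))]
  have h := lintegral_abs_mul_gaussianPDF_of_hasGaussianLaw (hasGaussianLaw_linearForms w v)
    (integral_linearForm w) (integral_linearForm v) (by rwa [hvar])
  rwa [hvar, hvar, covariance_linearForms] at h

/-! ### The Kac–Rice formula for the random polynomial. -/

theorem eval_evenBinomialPoly (d : ℕ) (a : Fin (d + 1) → ℝ) (x : ℝ) :
    (evenBinomialPoly d a).eval x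
      = ∑ k : Fin (d + 1), a k * √((2 * d).choose (2 * (k : ℕ)) : ℝ) * x ^ (2 * (k : ℕ)) := by
  simp [evenBinomialPoly, Polynomial.eval_finsetSum]

theorem measurable_numRealRoots (d : ℕ) :
    Measurable fun a : Fin (d + 1) → ℝ => numRealRoots (evenBinomialPoly d a) := by
  simp only [numRealRoots, Polynomial.IsRoot.def, eval_evenBinomialPoly]
  exact measurable_ncard_zeros (f := fun (a : Fin (d + 1) → ℝ) x =>
    ∑ k : Fin (d + 1), a k * √((2 * d).choose (2 * (k : ℕ)) : ℝ) * x ^ (2 * (k : ℕ)))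
    (by unfold Function.uncurry; fun_prop)

/-- The coefficient of `b k` in minus the non-constant part of the random polynomial. -/
noncomputable def tailWeight (m : ℕ) (k : Fin (m + 1)) (x : ℝ) : ℝ :=
  -(√((2 * (m + 1)).choose (2 * ((k : ℕ) + 1)) : ℝ) * x ^ (2 * ((k : ℕ) + 1)))

/-- The derivative of `tailWeight`. -/
noncomputable def tailWeightDeriv (m : ℕ) (k : Fin (m + 1)) (x : ℝ) : ℝ :=
  -(√((2 * (m + 1)).choose (2 * ((k : ℕ) + 1)) : ℝ) * (2 * ((k : ℕ) + 1) * x ^ (2 * (k : ℕ) + 1)))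

theorem continuous_tailWeight (m : ℕ) (k : Fin (m + 1)) : Continuous (tailWeight m k) := by
  unfold tailWeight; fun_prop

theorem continuous_tailWeightDeriv (m : ℕ) (k : Fin (m + 1)) :
    Continuous (tailWeightDeriv m k) := by
  unfold tailWeightDeriv; fun_prop

theorem hasDerivAt_tailWeight (m : ℕ) (k : Fin (m + 1)) (x : ℝ) :
    HasDerivAt (tailWeight m k) (tailWeightDeriv m k x) x := by
  have h := ((hasDerivAt_pow (2 * ((k : ℕ) + 1)) x).const_mul
    (√((2 * (m + 1)).choose (2 * ((k : ℕ) + 1)) : ℝ))).neg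
  refine h.congr_deriv ?_
  rw [tailWeightDeriv, show 2 * ((k : ℕ) + 1) - 1 = 2 * (k : ℕ) + 1 by omega]
  push_cast
  ring

/-- Splitting off the constant coefficient, whose weight is 1, exhibits the roots as a fibre over u.
-/
theorem eval_evenBinomialPoly_cons (m : ℕ) (u : ℝ) (b : Fin (m + 1) → ℝ) (x : ℝ) :
    (evenBinomialPoly (m + 1) (Fin.cons u b)).eval x = u - ∑ k, tailWeight m k x * b k := by
  rw [eval_evenBinomialPoly, Fin.sum_univ_succ, sub_eq_add_neg, ← Finset.sum_neg_distrib]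
  simp only [Fin.cons_zero, Fin.cons_succ, Fin.val_zero, Fin.val_succ, tailWeight]
  congr 1
  · simp
  · exact Finset.sum_congr rfl fun k _ => by ring

theorem one_add_sum_tailWeight_sq (m : ℕ) (x : ℝ) :
    1 + ∑ k, tailWeight m k x * tailWeight m k x
      = ((1 + x ^ 2) ^ (2 * (m + 1)) + (1 - x ^ 2) ^ (2 * (m + 1))) / 2 := by
  rw [← sum_choose_two_mul_pow, Finset.sum_range_succ', ← Fin.sum_univ_eq_sum_range
    (fun k => ((2 * (m + 1)).choose (2 * (k + 1)) : ℝ) * (x ^ 2) ^ (2 * (k + 1))), add_comm]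
  congr 1
  · refine Finset.sum_congr rfl fun k _ => ?_
    rw [tailWeight, neg_mul_neg, mul_mul_mul_comm, Real.mul_self_sqrt (Nat.cast_nonneg _)]
    ring
  · simp

/-- Since x d/dx multiplies x^(2k) by 2k, a factor x turns the sum into the Euler-operator sum at y
= x²; the k = 0 term of the latter is zero. -/
theorem sum_tailWeight_mul_deriv (m : ℕ) {x : ℝ} (hx : x ≠ 0) :
    ∑ k, tailWeight m k x * tailWeightDeriv m k x
      = x * ((m + 1) * ((1 + x ^ 2) ^ (2 * m + 1) - (1 - x ^ 2) ^ (2 * m + 1))) := by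
  refine mul_left_cancel₀ hx ?_
  rw [← mul_assoc, ← sq, ← sum_choose_mul_two_mul_pow, Finset.sum_range_succ',
    ← Fin.sum_univ_eq_sum_range (fun k => ((2 * (m + 1)).choose (2 * (k + 1)) : ℝ) *
      (2 * ((k + 1 : ℕ) : ℝ)) * (x ^ 2) ^ (2 * (k + 1))), Finset.mul_sum]
  simp only [Nat.cast_zero, mul_zero, zero_mul, add_zero]
  refine Finset.sum_congr rfl fun k _ => ?_
  rw [tailWeight, tailWeightDeriv, neg_mul_neg, mul_mul_mul_comm,
    Real.mul_self_sqrt (Nat.cast_nonneg _)]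
  push_cast
  ring

theorem sum_tailWeightDeriv_sq (m : ℕ) {x : ℝ} (hx : x ≠ 0) :
    ∑ k, tailWeightDeriv m k x * tailWeightDeriv m k x
      = (m + 1) * ((1 + x ^ 2) ^ (2 * m + 1) - (1 - x ^ 2) ^ (2 * m + 1))
        + x ^ 2 * ((m + 1) * (2 * m + 1) * ((1 + x ^ 2) ^ (2 * m) + (1 - x ^ 2) ^ (2 * m))) := by
  refine mul_left_cancel₀ (pow_ne_zero 2 hx) ?_
  rw [← sum_choose_mul_two_mul_sq_pow, Finset.sum_range_succ',
    ← Fin.sum_univ_eq_sum_range (fun k => ((2 * (m + 1)).choose (2 * (k + 1)) : ℝ) *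
      (2 * ((k + 1 : ℕ) : ℝ)) * (2 * ((k + 1 : ℕ) : ℝ)) * (x ^ 2) ^ (2 * (k + 1))), Finset.mul_sum]
  simp only [Nat.cast_zero, mul_zero, zero_mul, add_zero]
  refine Finset.sum_congr rfl fun k _ => ?_
  rw [tailWeightDeriv, neg_mul_neg, mul_mul_mul_comm, Real.mul_self_sqrt (Nat.cast_nonneg _)]
  push_cast
  ring

theorem lintegral_tail_eq_zeroDensity (m : ℕ) {x : ℝ} (hx : x ≠ 0) :
    ∫⁻ b, ENNReal.ofReal |∑ k, tailWeightDeriv m k x * b k|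
        * gaussianPDF 0 1 (∑ k, tailWeight m k x * b k) ∂gaussianPi (m + 1)
      = ENNReal.ofReal (zeroDensity m (x ^ 2) / Real.pi) := by
  have hpos : ∑ k, tailWeight m k x * tailWeight m k x ≠ 0 := by
    -- The variance of the tail is positive only away from x = 0, where every weight vanishes.
    refine (Finset.sum_pos (fun k _ => mul_self_pos.2 ?_) Finset.univ_nonempty).ne'
    have hc : 0 < (2 * (m + 1)).choose (2 * ((k : ℕ) + 1)) := Nat.choose_pos (by omega)
    have hc' : √((2 * (m + 1)).choose (2 * ((k : ℕ) + 1)) : ℝ) ≠ 0 := by positivity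
    exact neg_ne_zero.2 (mul_ne_zero hc' (pow_ne_zero _ hx))
  rw [lintegral_linearForms _ _ hpos, one_add_sum_tailWeight_sq, sum_tailWeight_mul_deriv m hx,
    sum_tailWeightDeriv_sq m hx, zeroDensity, div_div, mul_comm Real.pi]
  congr 4
  rw [mul_add 2 m 1, pow_add _ (2 * m), pow_add _ (2 * m), pow_add _ (2 * m), pow_add _ (2 * m)]
  generalize (1 + x ^ 2) ^ (2 * m) = A
  generalize (1 - x ^ 2) ^ (2 * m) = B
  ring

/-- The Kac–Rice formula for the random polynomial. -/
theorem lintegral_numRealRoots (m : ℕ) :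
    ∫⁻ a, (numRealRoots (evenBinomialPoly (m + 1) a) : ENNReal) ∂gaussianPi (m + 2)
      = ∫⁻ x : ℝ, ENNReal.ofReal (zeroDensity m (x ^ 2) / Real.pi) := by
  have hN : Measurable fun a : Fin (m + 2) → ℝ =>
      (numRealRoots (evenBinomialPoly (m + 1) a) : ENNReal) :=
    (measurable_from_top (f := fun n : ℕ => (n : ENNReal))).comp (measurable_numRealRoots (m + 1))
  have hmp := (measurePreserving_piFinSuccAbove
    (fun _ : Fin (m + 2) => gaussianReal 0 1) 0).symm
  have hw := fun k => (continuous_tailWeight m k).measurable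
  have hw' := fun k => (continuous_tailWeightDeriv m k).measurable
  have hφ := measurable_gaussianPDF 0 1
  rw [← hmp.lintegral_comp hN, lintegral_prod_symm' (f := fun z =>
      (numRealRoots (evenBinomialPoly (m + 1)
      ((MeasurableEquiv.piFinSuccAbove (fun _ : Fin (m + 2) => ℝ) 0).symm z)) : ENNReal))
    (hN.comp hmp.measurable)]
  have hinner : ∀ b : Fin (m + 1) → ℝ,
      ∫⁻ u, (numRealRoots (evenBinomialPoly (m + 1) (Fin.cons u b)) : ENNReal) ∂gaussianReal 0 1
      = ∫⁻ x, ENNReal.ofReal |∑ k, tailWeightDeriv m k x * b k|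
        * gaussianPDF 0 1 (∑ k, tailWeight m k x * b k) := by
    intro b
    have hcons : Measurable fun u : ℝ => (Fin.cons u b : Fin (m + 2) → ℝ) :=
      measurable_pi_lambda _ fun i => by
        refine Fin.cases ?_ (fun j => ?_) i
        · simpa using measurable_id'
        · simp
    rw [gaussianReal_of_var_ne_zero _ one_ne_zero,
      lintegral_withDensity_eq_lintegral_mul _ hφ (show Measurable fun u =>
        (numRealRoots (evenBinomialPoly (m + 1) (Fin.cons u b)) : ENNReal) from hN.comp hcons)]
    rw [← lintegral_encard_fiber_mul (g := fun x => ∑ k, tailWeight m k x * b k)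
      (g' := fun x => ∑ k, tailWeightDeriv m k x * b k)
      (fun x => HasDerivAt.fun_sum fun k _ => (hasDerivAt_tailWeight m k x).mul_const (b k))
      (continuous_finsetSum _ fun k _ => (continuous_tailWeightDeriv m k).mul continuous_const)
      hφ]
    refine lintegral_congr_ae ?_
    -- The value at x = 0 is u, so u ≠ 0 rules out the zero polynomial, for which `numRealRoots` is
    -- not the size of the fibre.
    filter_upwards [Measure.ae_ne volume (0 : ℝ)] with u hu
    have hset : {x | (evenBinomialPoly (m + 1) (Fin.cons u b)).IsRoot x}
        = {x | ∑ k, tailWeight m k x * b k = u} := by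
      ext x
      rw [Set.mem_ofPred_eq, Set.mem_ofPred_eq, Polynomial.IsRoot.def, eval_evenBinomialPoly_cons,
        sub_eq_zero, eq_comm]
    have hp : evenBinomialPoly (m + 1) (Fin.cons u b) ≠ 0 := by
      intro h0
      have h1 := eval_evenBinomialPoly_cons m u b 0
      rw [h0] at h1
      simp [tailWeight] at h1
      exact hu h1.symm
    have hfin : {x | ∑ k, tailWeight m k x * b k = u}.Finite := by
      rw [← hset]
      exact Polynomial.finite_setOfPred_isRoot hp
    rw [Pi.mul_apply, mul_comm, numRealRoots, hset, ← hfin.cast_ncard_eq]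
    simp
  calc _ = ∫⁻ b, ∫⁻ u, (numRealRoots (evenBinomialPoly (m + 1) (Fin.cons u b)) : ENNReal)
          ∂gaussianReal 0 1 ∂gaussianPi (m + 1) := by
        refine lintegral_congr fun b => lintegral_congr fun u => ?_
        simp [MeasurableEquiv.piFinSuccAbove, Fin.insertNthEquiv]
    _ = ∫⁻ b, (∫⁻ x, ENNReal.ofReal |∑ k, tailWeightDeriv m k x * b k|
        * gaussianPDF 0 1 (∑ k, tailWeight m k x * b k)) ∂gaussianPi (m + 1) :=
        lintegral_congr hinner
    _ = ∫⁻ x, ∫⁻ b, ENNReal.ofReal |∑ k, tailWeightDeriv m k x * b k|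
        * gaussianPDF 0 1 (∑ k, tailWeight m k x * b k) ∂gaussianPi (m + 1) := by
        refine lintegral_lintegral_swap (Measurable.aemeasurable ?_)
        unfold Function.uncurry
        refine Measurable.mul ?_ (hφ.comp ?_) <;> fun_prop
    _ = _ := by
        refine lintegral_congr_ae ?_
        filter_upwards [Measure.ae_ne volume (0 : ℝ)] with x hx
        exact lintegral_tail_eq_zeroDensity m hx

theorem numRealRoots_evenBinomialPoly_zero (a : Fin 1 → ℝ) :
    numRealRoots (evenBinomialPoly 0 a) = 0 := by
  have h : {x : ℝ | (evenBinomialPoly 0 a).IsRoot x} = {x : ℝ | a 0 = 0} := by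
    ext x
    simp [Polynomial.IsRoot.def, eval_evenBinomialPoly]
  rw [numRealRoots, h]
  by_cases h0 : a 0 = 0
  -- Every real is a root here, and `ncard` of an infinite set is 0.
  · simp [h0, Set.infinite_univ.ncard]
  · simp [h0]

/-! ### The expected number of roots. -/

theorem mainTheorem2 :
    ∃ C : ℝ, ∀ (d : ℕ) {Ω : Type*} [MeasurableSpace Ω] (μ : Measure Ω) [IsProbabilityMeasure μ]
      (a : Fin (d + 1) → Ω → ℝ),
      iIndepFun a μ → (∀ k, HasLaw (a k) (gaussianReal 0 1) μ) →
      Integrable (fun ω => (numRealRoots (evenBinomialPoly d (fun k => a k ω)) : ℝ)) μ ∧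
      |∫ ω, (numRealRoots (evenBinomialPoly d (fun k => a k ω)) : ℝ) ∂μ - √(2 * (d : ℝ))| ≤ C := by
  -- The bound 24π√2 of `integral_zeroDensity`, divided by the π of the density.
  refine ⟨24 * √2, ?_⟩
  intro d Ω _ μ _ a hind hlaw
  rcases d with _ | m
  · simp [numRealRoots_evenBinomialPoly_zero]
  have hpi : HasLaw (fun ω k => a k ω) (gaussianPi (m + 2)) μ := hind.hasLaw_pi hlaw
  have hN := measurable_numRealRoots (m + 1)
  have hNE : Measurable fun a : Fin (m + 2) → ℝ =>
      (numRealRoots (evenBinomialPoly (m + 1) a) : ENNReal) :=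
    (measurable_from_top (f := fun n : ℕ => (n : ENNReal))).comp hN
  have hNR : Measurable fun a : Fin (m + 2) → ℝ =>
      (numRealRoots (evenBinomialPoly (m + 1) a) : ℝ) :=
    (measurable_from_top (f := fun n : ℕ => (n : ℝ))).comp hN
  obtain ⟨hρ, hbound⟩ := integral_zeroDensity m
  have hρ' := hρ.div_const Real.pi
  have hρ0 : 0 ≤ᵐ[volume] fun x : ℝ => zeroDensity m (x ^ 2) / Real.pi :=
    ae_of_all _ fun x => div_nonneg (zeroDensity_nonneg _ _) Real.pi_pos.le
  have hlin : ∫⁻ ω, ENNReal.ofReal (numRealRoots (evenBinomialPoly (m + 1) fun k => a k ω) : ℝ) ∂μ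
      = ENNReal.ofReal (∫ x : ℝ, zeroDensity m (x ^ 2) / Real.pi) := by
    simp only [ENNReal.ofReal_natCast]
    rw [hpi.lintegral_comp hNE.aemeasurable, lintegral_numRealRoots,
      ofReal_integral_eq_lintegral_ofReal hρ' hρ0]
  have hmeas : AEStronglyMeasurable
      (fun ω => (numRealRoots (evenBinomialPoly (m + 1) fun k => a k ω) : ℝ)) μ :=
    (hNR.comp_aemeasurable hpi.aemeasurable).aestronglyMeasurable
  have hnn : 0 ≤ᵐ[μ] fun ω => (numRealRoots (evenBinomialPoly (m + 1) fun k => a k ω) : ℝ) :=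
    ae_of_all _ fun ω => Nat.cast_nonneg _
  refine ⟨⟨hmeas, (hasFiniteIntegral_iff_ofReal hnn).2 (hlin ▸ ENNReal.ofReal_lt_top)⟩, ?_⟩
  rw [integral_eq_lintegral_of_nonneg_ae hnn hmeas, hlin,
    ENNReal.toReal_ofReal (integral_nonneg_of_ae hρ0), integral_div]
  have hπ := Real.pi_pos
  push_cast
  rw [show ∀ I s : ℝ, I / Real.pi - s = (I - Real.pi * s) / Real.pi by intro I s; field_simp,
    abs_div, abs_of_pos hπ, div_le_iff₀ hπ]
  linarith
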